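/- Let $\mathcal R$ be the hyperfinite $\mathrm{II}_1$ factor, realized as follows. Let $\bigotimes_{n\ge1}M_2(\mathbb C)$ be the algebraic tensor product, i.e. the $*$-algebra of finite linear combinations of elementary tensors $\bigotimes_n x_n$ with $x_n\in M_2(\mathbb C)$ and $x_n=1$ for all but finitely many $n$, let $\tau(\bigotimes_n x_n)=\prod_n\frac12\mathrm{Tr}(x_n)$ be its product trace, and let $\mathcal H=L^2(\bigotimes_n M_2(\mathbb C),\tau)$ be the completion for the inner product $\langle x,y\rangle=\tau(x^*y)$. Then $\mathcal R\subset\mathcal B(\mathcal H)$ is the closure in the weak operator topology of $\bigotimes_n M_2(\mathbb C)$ acting on $\mathcal H$ by left multiplication. Put $$V=\begin{pmatrix}0&1\\0&0\end{pmatrix},\qquad V_n=I^{\otimes(n-1)}\otimes V\otimes I\otimes I\otimes\cdots\in\mathcal R,\qquad P_n=V_nV_n^*,\qquad Q_n=V_n^*V_n .$$ Let $\{c_n\}_{n\ge1}$ be a sequence of complex numbers with $\sum_n|c_n|<\infty$, let $A=\sum_{n\ge1}c_nV_n$ (the series converges in operator norm), and let $W^*(A)=\{A,A^*\}''$ be the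 von Neumann algebra generated by $A$. 1. If $c_n\ne0$ for all $n$ and $|c_i|\neq|c_j|$ whenever $i\ne j$, then $W^*(A)=\mathcal R$. 2. If $|c_n|=|c_m|$ for some $n\neq m$, then $W^*(A)$ is a proper subset of $\mathcal R$. If moreover $c_n\ne0$ (hence $c_m\neq 0$), then $$S_{n,m}=P_nQ_m+Q_nP_m-\frac{c_n}{c_m}V_nV_m^*-\frac{c_m}{c_n}V_n^*V_m$$ is a self-adjoint element of $\mathcal R$ that is not a scalar multiple of the identity and commutes with $A$. -/

import Mathlib

open scoped TensorProduct

noncomputable section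

namespace Hyperfinite

/-- The algebra `M₂(ℂ)`. -/
abbrev Mat2 : Type := Matrix (Fin 2) (Fin 2) ℂ

/-- The full tensor product of countably many copies of `M₂(ℂ)`. -/
def FullTensor : Type := ⨂[ℂ] _ : ℕ, Mat2

instance : Ring FullTensor := inferInstanceAs (Ring (⨂[ℂ] _ : ℕ, Mat2))

instance : Algebra ℂ FullTensor := inferInstanceAs (Algebra ℂ (⨂[ℂ] _ : ℕ, Mat2))

/-- The elementary tensor `⨂ xₙ`, as a multilinear map of the sequence `(xₙ)`. -/
def elem : MultilinearMap ℂ (fun _ : ℕ => Mat2) FullTensor := PiTensorProduct.tprod ℂ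

theorem elem_mul (x y : ℕ → Mat2) : elem x * elem y = elem (x * y) :=
  PiTensorProduct.tprod_mul_tprod x y

theorem elem_one : elem 1 = 1 := rfl

/-- A proposition about all tensors follows from the elementary ones. -/
theorem full_induction {p : FullTensor → Prop} (h1 : ∀ (r : ℂ) x, p (r • elem x))
    (h3 : ∀ s t, p s → p t → p (s + t)) (t : FullTensor) : p t :=
  PiTensorProduct.induction_on t h1 h3

/-- The involution, `(⨂ xₙ)* = ⨂ xₙ*`. -/
def starHom : FullTensor →+ FullTensor :=
  PiTensorProduct.liftAddHom (fun p : ℂ × (ℕ → Mat2) => star p.1 • elem (star p.2))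
    (by
      intro r f i hf
      have h : elem (star f) = 0 :=
        MultilinearMap.map_coord_zero _ i (by rw [Pi.star_apply, hf, star_zero])
      rw [h, smul_zero])
    (by intro f; simp)
    (by
      intro _ r f i a b
      have e : ∀ a : Mat2, star (Function.update f i a) = Function.update (star f) i (star a) := by
        intro a; exact (Function.update_star f i a).symm
      simp only [e, star_add, MultilinearMap.map_update_add, smul_add])
    (by intro r r' f; simp [add_smul])
    (by
      intro _ r f i r'
      have e : ∀ a : Mat2, star (Function.update f i a) = Function.update (star f) i (star a) := by
        intro a; exact (Function.update_star f i a).symm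
      simp only [e, star_smul, MultilinearMap.map_update_smul]
      rw [← Pi.star_apply, Function.update_eq_self, smul_smul, star_mul', mul_comm])

theorem starHom_smul_elem (r : ℂ) (x : ℕ → Mat2) :
    starHom (r • elem x) = star r • elem (star x) := by
  have h : r • elem x = PiTensorProduct.tprodCoeff ℂ r x :=
    (PiTensorProduct.tprodCoeff_eq_smul_tprod r x).symm
  rw [h]; rfl

theorem starHom_elem (x : ℕ → Mat2) : starHom (elem x) = elem (star x) := by
  simpa using starHom_smul_elem 1 x

theorem starHom_smul (r : ℂ) (t : FullTensor) : starHom (r • t) = star r • starHom t := by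
  refine full_induction (p := fun t => starHom (r • t) = star r • starHom t) ?_ ?_ t
  · intro s x
    rw [smul_smul, starHom_smul_elem, starHom_smul_elem, smul_smul, star_mul']
  · intro a b ha hb
    rw [smul_add, map_add, ha, hb, map_add, smul_add]

instance : StarRing FullTensor where
  star := starHom
  star_involutive t := by
    refine full_induction (p := fun t => starHom (starHom t) = t) ?_ ?_ t
    · intro r x; rw [starHom_smul_elem, starHom_smul_elem, star_star, star_star]
    · intro s t hs ht; rw [map_add, map_add, hs, ht]
  star_mul s t := by
    change starHom (s * t) = starHom t * starHom s
    refine full_induction (p := fun s => starHom (s * t) = starHom t * starHom s) ?_ ?_ s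
    · intro r x
      refine full_induction
        (p := fun t => starHom (r • elem x * t) = starHom t * starHom (r • elem x)) ?_ ?_ t
      · intro q y
        rw [smul_mul_smul_comm, elem_mul, starHom_smul_elem, starHom_smul_elem, starHom_smul_elem,
          smul_mul_smul_comm, elem_mul, star_mul, star_mul]
      · intro s t hs ht; rw [mul_add, map_add, hs, ht, map_add, add_mul]
    · intro s t hs ht; rw [add_mul, map_add, hs, ht, map_add, mul_add]
  star_add s t := map_add starHom s t

instance : StarModule ℂ FullTensor where
  star_smul r t := starHom_smul r t

theorem star_elem (x : ℕ → Mat2) : star (elem x) = elem (star x) := starHom_elem x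

/-- All but finitely many of the `xₙ` are `1`. -/
def EventuallyOne (x : ℕ → Mat2) : Prop := {n | x n ≠ 1}.Finite

theorem EventuallyOne.mul {x y : ℕ → Mat2} (hx : EventuallyOne x) (hy : EventuallyOne y) :
    EventuallyOne (x * y) := by
  refine (hx.union hy).subset fun n hn => ?_
  by_contra h
  simp only [Set.mem_union, Set.mem_ofPred_eq, not_or, not_not] at h
  exact hn (by rw [Pi.mul_apply, h.1, h.2, mul_one])

theorem EventuallyOne.star {x : ℕ → Mat2} (hx : EventuallyOne x) : EventuallyOne (star x) := by
  refine hx.subset fun n hn h => hn ?_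
  rw [Pi.star_apply, h, star_one]

theorem eventuallyOne_single (n : ℕ) (a : Mat2) : EventuallyOne (Pi.mulSingle n a) := by
  refine (Set.finite_singleton n).subset fun k hk => ?_
  by_contra h
  exact hk (Pi.mulSingle_eq_of_ne (M := fun _ => Mat2) h a)

theorem eventuallyOne_update [DecidableEq ℕ] {x : ℕ → Mat2} (i : ℕ) (a b : Mat2)
    (h : EventuallyOne (Function.update x i a)) : EventuallyOne (Function.update x i b) := by
  refine (h.union (Set.finite_singleton i)).subset fun n hn => ?_
  by_cases hni : n = i
  · exact Or.inr hni
  · left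
    simpa [Function.update_of_ne hni] using hn

/-- The algebraic tensor product `⨂ₙ M₂(ℂ)`: the finite linear combinations of elementary tensors
`⨂ xₙ` with all but finitely many `xₙ` equal to `1`. -/
def algTensor : StarSubalgebra ℂ FullTensor where
  carrier := Submodule.span ℂ {t | ∃ x, EventuallyOne x ∧ elem x = t}
  add_mem' := Submodule.add_mem _
  zero_mem' := Submodule.zero_mem _
  one_mem' := Submodule.subset_span ⟨1, by simp [EventuallyOne], rfl⟩
  algebraMap_mem' r := by
    rw [Algebra.algebraMap_eq_smul_one]
    exact Submodule.smul_mem _ _ (Submodule.subset_span ⟨1, by simp [EventuallyOne], rfl⟩)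
  mul_mem' {a b} ha hb := by
    change a ∈ Submodule.span ℂ _ at ha
    change b ∈ Submodule.span ℂ _ at hb
    change a * b ∈ Submodule.span ℂ _
    induction ha, hb using Submodule.span_induction₂ with
    | mem_mem s t hs ht =>
      obtain ⟨x, hx, rfl⟩ := hs
      obtain ⟨y, hy, rfl⟩ := ht
      exact Submodule.subset_span ⟨x * y, hx.mul hy, (elem_mul x y).symm⟩
    | zero_left t ht => rw [zero_mul]; exact Submodule.zero_mem _
    | zero_right t ht => rw [mul_zero]; exact Submodule.zero_mem _
    | add_left s t u _ _ _ h1 h2 => rw [add_mul]; exact Submodule.add_mem _ h1 h2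
    | add_right s t u _ _ _ h1 h2 => rw [mul_add]; exact Submodule.add_mem _ h1 h2
    | smul_left r s t _ _ h => rw [smul_mul_assoc]; exact Submodule.smul_mem _ _ h
    | smul_right r s t _ _ h => rw [mul_smul_comm]; exact Submodule.smul_mem _ _ h
  star_mem' {a} ha := by
    change a ∈ Submodule.span ℂ _ at ha
    change star a ∈ Submodule.span ℂ _
    induction ha using Submodule.span_induction with
    | mem t ht =>
      obtain ⟨x, hx, rfl⟩ := ht
      exact Submodule.subset_span ⟨star x, hx.star, (star_elem x).symm⟩
    | zero => rw [star_zero]; exact Submodule.zero_mem _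
    | add s t _ _ h1 h2 => rw [star_add]; exact Submodule.add_mem _ h1 h2
    | smul r s _ h => rw [star_smul]; exact Submodule.smul_mem _ _ h

theorem elem_mem {x : ℕ → Mat2} (hx : EventuallyOne x) : elem x ∈ algTensor :=
  Submodule.subset_span ⟨x, hx, rfl⟩

/-- The normalized trace of `M₂(ℂ)`. -/
def tr2 (a : Mat2) : ℂ := a.trace / 2

theorem tr2_one : tr2 1 = 1 := by simp [tr2]

theorem tr2_add (a b : Mat2) : tr2 (a + b) = tr2 a + tr2 b := by
  rw [tr2, tr2, tr2, Matrix.trace_add, add_div]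

theorem tr2_smul (r : ℂ) (a : Mat2) : tr2 (r • a) = r * tr2 a := by
  rw [tr2, tr2, Matrix.trace_smul, smul_eq_mul, mul_div_assoc]

theorem mulSupport_tr2 (x : ℕ → Mat2) :
    (Function.mulSupport fun n => tr2 (x n)) ⊆ {n | x n ≠ 1} := by
  intro n hn h
  exact hn (by change tr2 (x n) = 1; rw [show x n = 1 from h, tr2_one])

theorem finprod_update [DecidableEq ℕ] {x : ℕ → Mat2} {i : ℕ} {a : Mat2}
    (h : EventuallyOne (Function.update x i a)) (b : Mat2) :
    ∏ᶠ n, tr2 (Function.update x i b n) = tr2 b * ∏ᶠ (n) (_ : n ≠ i), tr2 (x n) := by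
  have hb := eventuallyOne_update i a b h
  rw [← mul_finprod_cond_ne i (hb.subset (mulSupport_tr2 _)), Function.update_self]
  congr 1
  refine finprod_congr fun n => finprod_congr fun hn => ?_
  rw [Function.update_of_ne hn]

open Classical in
/-- The multilinear map that sends `(xₙ)` to `∏ tr(xₙ)` if all but finitely many `xₙ` are `1`
(the only sequences that matter for `algTensor`), and to `0` otherwise. -/
def traceMultilinear : MultilinearMap ℂ (fun _ : ℕ => Mat2) ℂ where
  toFun x := if EventuallyOne x then ∏ᶠ n, tr2 (x n) else 0
  map_update_add' x i a b := by
    by_cases h : EventuallyOne (Function.update x i a)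
    · rw [if_pos (eventuallyOne_update i a _ h), if_pos h, if_pos (eventuallyOne_update i a _ h),
        finprod_update h (a + b), finprod_update h a, finprod_update h b, tr2_add,
        add_mul]
    · rw [if_neg fun h' => h (eventuallyOne_update i _ a h'), if_neg h,
        if_neg fun h' => h (eventuallyOne_update i _ a h'), add_zero]
  map_update_smul' x i r a := by
    by_cases h : EventuallyOne (Function.update x i a)
    · rw [if_pos (eventuallyOne_update i a _ h), if_pos h, finprod_update h (r • a),
        finprod_update h a, tr2_smul, mul_assoc, smul_eq_mul]
    · rw [if_neg fun h' => h (eventuallyOne_update i _ a h'), if_neg h, smul_zero]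

/-- The product state `τ (⨂ xₙ) = ∏ tr(xₙ)`. -/
def trace : FullTensor →ₗ[ℂ] ℂ :=
  PiTensorProduct.lift traceMultilinear

theorem trace_elem {x : ℕ → Mat2} (hx : EventuallyOne x) :
    trace (elem x) = ∏ᶠ n, tr2 (x n) := by
  have h : trace (elem x) = traceMultilinear x := PiTensorProduct.lift.tprod x
  rw [h]
  exact if_pos hx

theorem trace_star (t : FullTensor) : trace (star t) = star (trace t) := by
  refine full_induction (p := fun t => trace (star t) = star (trace t)) ?_ ?_ t
  · intro r x
    rw [star_smul, star_elem, map_smul, map_smul, star_smul]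
    congr 1
    have e : ∀ x, trace (elem x) = traceMultilinear x := fun x => PiTensorProduct.lift.tprod x
    by_cases h : EventuallyOne x
    · have hs : {n | x n ≠ 1}.Finite := h
      rw [trace_elem h, trace_elem h.star, finprod_eq_prod_of_mulSupport_subset (s := hs.toFinset),
        finprod_eq_prod_of_mulSupport_subset (s := hs.toFinset), star_prod]
      · refine Finset.prod_congr rfl fun n _ => ?_
        rw [Pi.star_apply, tr2, tr2, Matrix.star_eq_conjTranspose, Matrix.trace_conjTranspose,
          star_div₀]
        simp
      · exact fun n hn => hs.mem_toFinset.2 (mulSupport_tr2 x hn)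
      · refine fun n hn => hs.mem_toFinset.2 fun h' => mulSupport_tr2 (star x) hn ?_
        rw [Pi.star_apply, h', star_one]
    · have h0 : ∀ x, ¬EventuallyOne x → traceMultilinear x = 0 := fun x hx => if_neg hx
      rw [e, e, h0 x h, h0 (star x) fun h' => h (by simpa using h'.star), star_zero]
  · intro s t hs ht; rw [star_add, map_add, hs, ht, map_add, star_add]

theorem tr2_star_mul (a b : Mat2) :
    tr2 (star a * b) = ∑ p : Fin 2 × Fin 2, star (a p.1 p.2) * b p.1 p.2 / 2 := by
  rw [tr2, Matrix.star_eq_conjTranspose, Fintype.sum_prod_type]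
  simp only [Matrix.trace, Matrix.diag, Matrix.mul_apply, Matrix.conjTranspose_apply,
    Fin.sum_univ_two]
  ring

theorem trace_star_mul_self_nonneg {t : FullTensor} (ht : t ∈ algTensor) :
    0 ≤ (trace (star t * t)).re := by
  obtain ⟨k, a, g, rfl⟩ := Submodule.mem_span_set'.1
    (show t ∈ Submodule.span ℂ {t | ∃ x, EventuallyOne x ∧ elem x = t} from ht)
  choose X hX hg using fun i => (g i).2
  classical
  let s : Finset ℕ := Finset.univ.biUnion fun i => (hX i).toFinset
  have hs : ∀ i n, n ∉ s → X i n = 1 := by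
    intro i n hn
    by_contra h
    exact hn (Finset.mem_biUnion.2 ⟨i, Finset.mem_univ _, (hX i).mem_toFinset.2 h⟩)
  let P := s.pi fun _ => (Finset.univ : Finset (Fin 2 × Fin 2))
  let z : (∀ n ∈ s, Fin 2 × Fin 2) → Fin k → ℂ :=
    fun p i => ∏ n ∈ s.attach, X i n.1 (p n.1 n.2).1 (p n.1 n.2).2
  have key : ∀ i j, trace (elem (star (X i) * X j)) =
      ∑ p ∈ P, star (z p i) * z p j / 2 ^ s.card := by
    intro i j
    rw [trace_elem ((hX i).star.mul (hX j)), finprod_eq_prod_of_mulSupport_subset (s := s)]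
    · simp only [Pi.mul_apply, Pi.star_apply, tr2_star_mul]
      rw [Finset.prod_sum]
      refine Finset.sum_congr rfl fun p _ => ?_
      rw [Finset.prod_div_distrib, Finset.prod_mul_distrib, star_prod, Finset.prod_const,
        Finset.card_attach]
    · refine (mulSupport_tr2 _).trans fun n hn => ?_
      by_contra h
      exact hn (by rw [Pi.mul_apply, Pi.star_apply, hs i n h, hs j n h, star_one, mul_one])
  have total : trace (star (∑ i, a i • (g i : FullTensor)) * ∑ i, a i • (g i : FullTensor)) =
      ∑ p ∈ P, star (∑ i, a i * z p i) * (∑ i, a i * z p i) / 2 ^ s.card := by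
    have e : ∀ i, (g i : FullTensor) = elem (X i) := fun i => (hg i).symm
    have l : trace (star (∑ i, a i • elem (X i)) * ∑ i, a i • elem (X i)) =
        ∑ i, ∑ j, star (a i) * a j * ∑ p ∈ P, star (z p i) * z p j / 2 ^ s.card := by
      rw [star_sum, Finset.sum_mul_sum, map_sum]
      refine Finset.sum_congr rfl fun i _ => ?_
      rw [map_sum]
      refine Finset.sum_congr rfl fun j _ => ?_
      rw [star_smul, star_elem, smul_mul_smul_comm, elem_mul, map_smul, key, smul_eq_mul]
    simp only [e]
    rw [l]
    simp only [Finset.mul_sum]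
    rw [Finset.sum_congr rfl fun i _ => Finset.sum_comm, Finset.sum_comm]
    refine Finset.sum_congr rfl fun p _ => ?_
    rw [Finset.sum_comm, Finset.sum_div]
    refine Finset.sum_congr rfl fun j _ => ?_
    rw [star_sum, Finset.sum_mul, Finset.sum_div]
    refine Finset.sum_congr rfl fun i _ => ?_
    rw [star_mul']
    ring
  rw [total, Complex.re_sum]
  refine Finset.sum_nonneg fun p _ => ?_
  have h2 : ∀ w : ℂ, (star w * w / 2 ^ s.card).re = Complex.normSq w / 2 ^ s.card := by
    intro w
    rw [Complex.star_def, ← Complex.normSq_eq_conj_mul_self]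
    norm_cast
  rw [h2]
  exact div_nonneg (Complex.normSq_nonneg _) (by positivity)

/-! ### The standard representation -/

/-- The algebraic tensor product, regarded as the pre-Hilbert space with inner product
`⟪x, y⟫ = τ (x* y)`. -/
def PreL2 : Type := algTensor

instance : AddCommGroup PreL2 := inferInstanceAs (AddCommGroup algTensor)

instance : Module ℂ PreL2 := inferInstanceAs (Module ℂ algTensor)

/-- An element of the algebra, regarded as a vector. -/
def toL2 : algTensor ≃ₗ[ℂ] PreL2 := LinearEquiv.refl ℂ _

/-- The pre-inner product `⟪x, y⟫ = τ (x* y)`. -/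
abbrev preL2Core : PreInnerProductSpace.Core ℂ PreL2 where
  inner x y := trace (star (toL2.symm x : FullTensor) * (toL2.symm y : FullTensor))
  conj_inner_symm x y := by
    rw [← Complex.star_def, ← trace_star, star_mul, star_star]
  re_inner_nonneg x := trace_star_mul_self_nonneg (toL2.symm x).2
  add_left x y z := by
    rw [map_add, AddMemClass.coe_add, star_add, add_mul, map_add]
  smul_left x y r := by
    rw [map_smul, SetLike.val_smul, star_smul, smul_mul_assoc, map_smul]; rfl

instance : SeminormedAddCommGroup PreL2 :=
  InnerProductSpace.Core.toSeminormedAddCommGroup (c := preL2Core)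

instance : InnerProductSpace ℂ PreL2 := InnerProductSpace.ofCore preL2Core

theorem inner_toL2 (x y : algTensor) :
    inner ℂ (toL2 x) (toL2 y) = trace ((star x * y : algTensor) : FullTensor) := rfl

/-- The Hilbert space `L²(⨂ M₂(ℂ), τ)`. -/
def L2 : Type := UniformSpace.Completion PreL2

instance : NormedAddCommGroup L2 :=
  inferInstanceAs (NormedAddCommGroup (UniformSpace.Completion PreL2))

instance : InnerProductSpace ℂ L2 :=
  inferInstanceAs (InnerProductSpace ℂ (UniformSpace.Completion PreL2))

instance : CompleteSpace L2 := inferInstanceAs (CompleteSpace (UniformSpace.Completion PreL2))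

/-- The vector of `L2` given by an element of the algebra. -/
def vec (a : algTensor) : L2 := ((toL2 a : PreL2) : UniformSpace.Completion PreL2)

theorem inner_vec (x y : algTensor) :
    inner ℂ (vec x) (vec y) = trace ((star x * y : algTensor) : FullTensor) :=
  UniformSpace.Completion.inner_coe (toL2 x) (toL2 y)

theorem vec_add (x y : algTensor) : vec (x + y) = vec x + vec y :=
  UniformSpace.Completion.coe_add (toL2 x) (toL2 y)

theorem vec_smul (r : ℂ) (x : algTensor) : vec (r • x) = r • vec x :=
  UniformSpace.Completion.coe_smul r (toL2 x)

theorem vec_zero : vec 0 = 0 := UniformSpace.Completion.coe_zero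

theorem denseRange_vec : DenseRange vec :=
  UniformSpace.Completion.denseRange_coe.comp toL2.surjective.denseRange
    (UniformSpace.Completion.continuous_coe _)

theorem norm_sq_toL2 (x : algTensor) :
    ((‖toL2 x‖ ^ 2 : ℝ) : ℂ) = trace ((star x * x : algTensor) : FullTensor) := by
  rw [← inner_toL2, inner_self_eq_norm_sq_to_K]; norm_cast

/-- The matrix `a` in the `n`-th tensor factor, and `1` in all the others. -/
def site (n : ℕ) (a : Mat2) : algTensor :=
  ⟨elem (Pi.mulSingle n a), elem_mem (eventuallyOne_single n a)⟩

theorem site_mul (n : ℕ) (a b : Mat2) : site n a * site n b = site n (a * b) :=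
  Subtype.ext (by
    change elem _ * elem _ = elem _
    rw [elem_mul, ← Pi.mulSingle_mul])

theorem site_star (n : ℕ) (a : Mat2) : star (site n a) = site n (star a) :=
  Subtype.ext (by
    change star (elem _) = elem _
    rw [star_elem]
    congr 1
    funext k
    by_cases hk : k = n
    · subst hk; rw [Pi.star_apply, Pi.mulSingle_eq_same, Pi.mulSingle_eq_same]
    · rw [Pi.star_apply, Pi.mulSingle_eq_of_ne hk, Pi.mulSingle_eq_of_ne hk, star_one])

theorem site_add (n : ℕ) (a b : Mat2) : site n (a + b) = site n a + site n b :=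
  Subtype.ext (elem.map_update_add 1 n a b)

theorem site_smul (n : ℕ) (r : ℂ) (a : Mat2) : site n (r • a) = r • site n a :=
  Subtype.ext (elem.map_update_smul 1 n r a)

theorem site_one (n : ℕ) : site n 1 = 1 :=
  Subtype.ext (by
    change elem (Pi.mulSingle n 1) = 1
    rw [Pi.mulSingle_one, elem_one])

/-- Left multiplication by `a` is bounded for the norm of `PreL2`. -/
def LeftBounded (a : algTensor) : Prop :=
  ∃ C : ℝ, ∀ b : algTensor, ‖toL2 (a * b)‖ ≤ C * ‖toL2 b‖

theorem LeftBounded.add {a b : algTensor} (ha : LeftBounded a) (hb : LeftBounded b) :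
    LeftBounded (a + b) := by
  obtain ⟨C, hC⟩ := ha
  obtain ⟨D, hD⟩ := hb
  refine ⟨C + D, fun x => ?_⟩
  rw [add_mul, add_mul, map_add]
  exact (norm_add_le _ _).trans (add_le_add (hC x) (hD x))

theorem LeftBounded.smul {a : algTensor} (r : ℂ) (ha : LeftBounded a) : LeftBounded (r • a) := by
  obtain ⟨C, hC⟩ := ha
  refine ⟨‖r‖ * C, fun x => ?_⟩
  rw [smul_mul_assoc, map_smul, norm_smul, mul_assoc]
  exact mul_le_mul_of_nonneg_left (hC x) (norm_nonneg _)

theorem LeftBounded.mul {a b : algTensor} (ha : LeftBounded a) (hb : LeftBounded b) :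
    LeftBounded (a * b) := by
  obtain ⟨C, hC⟩ := ha
  obtain ⟨D, hD⟩ := hb
  refine ⟨|C| * D, fun x => ?_⟩
  rw [mul_assoc, mul_assoc]
  refine (hC _).trans ?_
  exact (mul_le_mul_of_nonneg_right (le_abs_self C) (norm_nonneg _)).trans
    (mul_le_mul_of_nonneg_left (hD x) (abs_nonneg C))

theorem leftBounded_one : LeftBounded 1 := ⟨1, fun x => by rw [one_mul, one_mul]⟩

theorem leftBounded_site (n : ℕ) (a : Mat2) : LeftBounded (site n a) := by
  obtain ⟨y, r, hr⟩ : ∃ (y : Mat2) (r : ℝ), star a * a + star y * y = (r : ℂ) • (1 : Mat2) := by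
    refine ⟨star a.adjugate, Complex.normSq (a 0 0) + Complex.normSq (a 0 1) +
      Complex.normSq (a 1 0) + Complex.normSq (a 1 1), ?_⟩
    push_cast
    rw [star_star, Matrix.adjugate_fin_two]
    ext i j
    fin_cases i <;> fin_cases j <;>
      simp [Complex.normSq_eq_conj_mul_self, Matrix.mul_apply, Fin.sum_univ_two,
        Matrix.star_apply, -Matrix.cons_mul] <;> ring
  have key : ∀ b : algTensor,
      ‖toL2 (site n a * b)‖ ^ 2 + ‖toL2 (site n y * b)‖ ^ 2 = r * ‖toL2 b‖ ^ 2 := by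
    intro b
    have h : star (site n a * b) * (site n a * b) + star (site n y * b) * (site n y * b) =
        (r : ℂ) • (star b * b) := by
      have e : star (site n a) * site n a + star (site n y) * site n y = (r : ℂ) • 1 := by
        rw [site_star, site_star, site_mul, site_mul, ← site_add, hr, site_smul, site_one]
      calc _ = star b * (star (site n a) * site n a + star (site n y) * site n y) * b := by
              rw [star_mul, star_mul]; noncomm_ring
        _ = _ := by rw [e, mul_smul_comm, mul_one, smul_mul_assoc]
    have h' := congrArg (fun t : algTensor => trace (t : FullTensor)) h
    simp only [AddMemClass.coe_add, SetLike.val_smul, map_add, map_smul, ← norm_sq_toL2,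
      smul_eq_mul] at h'
    exact_mod_cast h'
  refine ⟨√|r|, fun b => ?_⟩
  refine abs_le_of_sq_le_sq' ?_ (by positivity) |>.2
  rw [mul_pow, Real.sq_sqrt (abs_nonneg r)]
  have h1 := key b
  have h2 := mul_le_mul_of_nonneg_right (le_abs_self r) (sq_nonneg ‖toL2 b‖)
  nlinarith [sq_nonneg ‖toL2 (site n y * b)‖]

theorem leftBounded_elem (s : Finset ℕ) : ∀ (x : ℕ → Mat2) (hx : EventuallyOne x),
    (∀ n ∉ s, x n = 1) → LeftBounded ⟨elem x, elem_mem hx⟩ := by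
  classical
  induction s using Finset.induction_on with
  | empty =>
    intro x hx h
    obtain rfl : x = 1 := funext fun n => h n (Finset.notMem_empty n)
    exact leftBounded_one
  | insert i s hi ih =>
    intro x hx h
    have hu : EventuallyOne (Function.update x i 1) :=
      eventuallyOne_update i (x i) 1 (by rwa [Function.update_eq_self])
    have e : (⟨elem x, elem_mem hx⟩ : algTensor) =
        site i (x i) * ⟨elem (Function.update x i 1), elem_mem hu⟩ := by
      refine Subtype.ext ?_
      change elem x = elem _ * elem _
      rw [elem_mul]
      congr 1
      funext n
      by_cases hn : n = i
      · subst hn; simp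
      · simp [hn]
    rw [e]
    refine (leftBounded_site _ _).mul (ih _ hu fun n hn => ?_)
    by_cases hni : n = i
    · subst hni; simp
    · rw [Function.update_of_ne hni]
      exact h n (by simp [hni, hn])

theorem leftBounded (a : algTensor) : LeftBounded a := by
  have h : ∀ t ∈ Submodule.span ℂ {t | ∃ x, EventuallyOne x ∧ elem x = t},
      ∃ b : algTensor, (b : FullTensor) = t ∧ LeftBounded b := by
    intro t ht
    induction ht using Submodule.span_induction with
    | mem t h =>
      obtain ⟨x, hx, rfl⟩ := h
      have hs : {n | x n ≠ 1}.Finite := hx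
      refine ⟨⟨elem x, elem_mem hx⟩, rfl, leftBounded_elem hs.toFinset x hx fun n hn => ?_⟩
      by_contra h
      exact hn (hs.mem_toFinset.2 h)
    | zero => exact ⟨0, rfl, 0, fun x => by rw [zero_mul, map_zero, norm_zero, zero_mul]⟩
    | add s t _ _ h1 h2 =>
      obtain ⟨b, rfl, hb⟩ := h1
      obtain ⟨c, rfl, hc⟩ := h2
      exact ⟨b + c, rfl, hb.add hc⟩
    | smul r s _ h =>
      obtain ⟨b, rfl, hb⟩ := h
      exact ⟨r • b, rfl, hb.smul r⟩
  obtain ⟨b, hb, hb'⟩ := h a a.2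
  rwa [Subtype.ext hb] at hb'

/-- Left multiplication by `a` on the pre-Hilbert space. -/
def leftMul (a : algTensor) : PreL2 →L[ℂ] PreL2 :=
  LinearMap.mkContinuousOfExistsBound
    (toL2.toLinearMap ∘ₗ LinearMap.mulLeft ℂ a ∘ₗ toL2.symm.toLinearMap)
    (by
      obtain ⟨C, hC⟩ := leftBounded a
      exact ⟨C, fun x => hC (toL2.symm x)⟩)

theorem leftMul_toL2 (a b : algTensor) : leftMul a (toL2 b) = toL2 (a * b) := rfl

/-- The bounded operator on `L2` that extends left multiplication by `a`. -/
def leftMulL2 (a : algTensor) : L2 →L[ℂ] L2 := (leftMul a).completion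

theorem leftMulL2_vec (a b : algTensor) : leftMulL2 a (vec b) = vec (a * b) :=
  ContinuousLinearMap.completion_apply_coe (leftMul a) (toL2 b)

theorem L2_ext {S T : L2 →L[ℂ] L2} (h : ∀ b : algTensor, S (vec b) = T (vec b)) : S = T :=
  ContinuousLinearMap.ext fun x =>
    congrFun (denseRange_vec.equalizer S.continuous T.continuous (funext h)) x

/-- The representation of the algebraic tensor product on `L2` by left multiplication. -/
def leftRep : algTensor →⋆ₐ[ℂ] (L2 →L[ℂ] L2) where
  toFun := leftMulL2
  map_one' := L2_ext fun b => by
    rw [leftMulL2_vec, one_mul, one_apply_eq_self]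
  map_mul' a b := L2_ext fun c => by
    rw [mul_apply_eq_comp, leftMulL2_vec, leftMulL2_vec, leftMulL2_vec, mul_assoc]
  map_zero' := L2_ext fun c => by
    rw [leftMulL2_vec, zero_mul, vec_zero, _root_.zero_apply]
  map_add' a b := L2_ext fun c => by
    rw [_root_.add_apply, leftMulL2_vec, leftMulL2_vec, leftMulL2_vec, add_mul, vec_add]
  commutes' r := L2_ext fun c => by
    rw [leftMulL2_vec, Algebra.algebraMap_eq_smul_one, smul_mul_assoc, one_mul, vec_smul,
      Algebra.algebraMap_eq_smul_one]
    rfl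
  map_star' a := by
    refine (ContinuousLinearMap.eq_adjoint_iff _ _).mpr fun x y => ?_
    refine denseRange_vec.induction_on₂ (p := fun x y =>
      inner ℂ (leftMulL2 (star a) x) y = inner ℂ x (leftMulL2 a y)) ?_ (fun x y => ?_) x y
    · exact isClosed_eq
        (((leftMulL2 (star a)).continuous.comp continuous_fst).inner continuous_snd)
        (continuous_fst.inner ((leftMulL2 a).continuous.comp continuous_snd))
    · rw [leftMulL2_vec, leftMulL2_vec, inner_vec, inner_vec, star_mul, star_star, mul_assoc]

theorem leftRep_vec (a b : algTensor) : leftRep a (vec b) = vec (a * b) := leftMulL2_vec a b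

/-- The hyperfinite II₁ factor `R`: the closure, in the weak operator topology, of the algebraic
tensor product `⨂ₙ M₂(ℂ)` acting by left multiplication on `L²(⨂ₙ M₂(ℂ), τ)`. -/
def hyperfiniteFactor : Set (L2 →L[ℂ] L2) :=
  {T | ContinuousLinearMapWOT.ofCLM T ∈
    closure (ContinuousLinearMapWOT.ofCLM '' Set.range leftRep)}

/-- The von Neumann algebra `W*(T) = {T, T*}''` generated by an operator `T`. -/
def vonNeumannGenerated (T : L2 →L[ℂ] L2) : Set (L2 →L[ℂ] L2) :=
  Set.centralizer (Set.centralizer {T, star T})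

/-- The matrix `V`. -/
def matV : Mat2 := !![0, 1; 0, 0]

/-- The operator `Vₙ`; the tensor factors are numbered from `0`. -/
def opV (n : ℕ) : L2 →L[ℂ] L2 := leftRep (site n matV)

/-- The projection `Pₙ = Vₙ Vₙ*`. -/
def opP (n : ℕ) : L2 →L[ℂ] L2 := opV n * star (opV n)

/-- The projection `Qₙ = Vₙ* Vₙ`. -/
def opQ (n : ℕ) : L2 →L[ℂ] L2 := star (opV n) * opV n

/-- The operator `A = ∑ cₙ Vₙ`, a series that converges in operator norm if `∑ |cₙ| < ∞`
(see `hasSum_opA`). -/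
def opA (c : ℕ → ℂ) : L2 →L[ℂ] L2 := ∑' n, c n • opV n

/-- The operator `Sₙₘ = Pₙ Qₘ + Qₙ Pₘ - (cₙ / cₘ) Vₙ Vₘ* - (cₘ / cₙ) Vₙ* Vₘ`. -/
def opS (c : ℕ → ℂ) (n m : ℕ) : L2 →L[ℂ] L2 :=
  opP n * opQ m + opQ n * opP m - (c n / c m) • (opV n * star (opV m)) -
    (c m / c n) • (star (opV n) * opV m)

theorem norm_le_one_of_partialIsometry {E : Type*} [NonUnitalNormedRing E] [StarRing E]
    [CStarRing E] {v : E} (e : v * star v * v = v) : ‖v‖ ≤ 1 := by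
  have h1 : ‖star v * v‖ = ‖v‖ * ‖v‖ := CStarRing.norm_star_mul_self
  have h2 : ‖star v * v‖ ≤ 1 ∨ ‖v‖ = 0 := by
    have h3 : ‖star v * v‖ * ‖star v * v‖ = ‖star v * v‖ := by
      rw [← CStarRing.norm_star_mul_self (x := star v * v), star_mul, star_star,
        ← mul_assoc, mul_assoc (star v), mul_assoc (star v), e]
    by_cases h0 : ‖star v * v‖ = 0
    · right; rw [h1] at h0; simpa using h0
    · left; exact (mul_left_cancel₀ h0 (h3.trans (mul_one _).symm)).le
  rcases h2 with h2 | h2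
  · rw [h1] at h2; nlinarith [norm_nonneg v]
  · rw [h2]; exact zero_le_one

theorem norm_opV_le (n : ℕ) : ‖opV n‖ ≤ 1 := by
  have h : matV * star matV * matV = matV := by
    rw [matV]
    ext i j
    fin_cases i <;> fin_cases j <;>
      simp [Matrix.mul_apply, Fin.sum_univ_two, Matrix.star_apply, -Matrix.cons_mul]
  have e : opV n * star (opV n) * opV n = opV n := by
    rw [opV, ← map_star, ← map_mul, ← map_mul, site_star, site_mul, site_mul, h]
  exact norm_le_one_of_partialIsometry e

theorem hasSum_opA {c : ℕ → ℂ} (hc : Summable fun n => ‖c n‖) :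
    HasSum (fun n => c n • opV n) (opA c) := by
  refine Summable.hasSum (Summable.of_norm_bounded hc fun n => ?_)
  rw [norm_smul]
  exact mul_le_of_le_one_right (norm_nonneg _) (norm_opV_le n)

end Hyperfinite

end

/-!
By von Neumann's double commutant theorem (`StarSubalgebra.ofCLM_mem_closure_iff`), `R` is the
bicommutant of the algebraic tensor product acting on `L²`. An operator that commutes with every
`Vₙ` and `Vₙ*` commutes with that whole algebra, because the matrix units at the single sites
generate it. So both assertions are about the commutant `{A, A*}'`, and `W*(A) ⊆ R` always holds.

For the first assertion, the derivation `ad [A, A*]` maps `Vₙ` to `2 |cₙ|² Vₙ`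
(`commutator_mul_opV_sub`), since only the `n`-th term of `A` fails to commute with `Vₙ` or `Vₙ*`.
Its iterates at `A` are the sums `∑ (2 |cₙ|²)ᵏ cₙ Vₙ`, so every `T ∈ {A, A*}'` satisfies
`∑ (2 |cₙ|²)ᵏ cₙ [T, Vₙ] = 0` for all `k`. The weights are distinct, positive and tend to zero, and
comparing growth in `k` gives `[T, Vₙ] = 0` for all `n`
(`eq_zero_of_forall_tsum_pow_smul_eq_zero`). Hence `{A, A*}'` is the commutant of `R`.

For the second assertion, some element of `R ∩ {A, A*}'` fails to commute with an element of `R`.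
If `cₙ = 0`, this is `Vₙ`, which does not commute with `Vₙ*`. If `cₙ ≠ 0`, it is the self-adjoint
operator `Sₙₘ`: it commutes with `A` by a computation in the `n`-th and `m`-th factors
(`opS_commute_opA`), but not with `Pₙ` (`not_commute_opS_opP`). For the latter reason it is also
not a scalar.
-/

/-! ### The double commutant theorem -/

section DoubleCommutant

variable {H : Type*} [NormedAddCommGroup H] [InnerProductSpace ℂ H]

/-- The amplification of an operator `T` on `H`, acting diagonally on the Hilbert sum of copies
of `H` indexed by `ι`. -/
noncomputable def ContinuousLinearMap.amplify (ι : Type*) [Fintype ι] :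
    (H →L[ℂ] H) →ₗ[ℂ] PiLp 2 (fun _ : ι => H) →L[ℂ] PiLp 2 (fun _ : ι => H) where
  toFun T := (PiLp.continuousLinearEquiv 2 ℂ fun _ : ι => H).symm.toContinuousLinearMap ∘L
    ContinuousLinearMap.pi fun i => T ∘L PiLp.proj 2 (fun _ : ι => H) i
  map_add' S T := by ext; simp
  map_smul' r T := by ext; simp

theorem ContinuousLinearMap.amplify_apply {ι : Type*} [Fintype ι] (T : H →L[ℂ] H)
    (x : PiLp 2 fun _ : ι => H) (i : ι) : amplify ι T x i = T (x i) := rfl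

/-- The centralizer of any set of operators is closed in the weak operator topology. -/
theorem isClosed_image_ofCLM_centralizer (s : Set (H →L[ℂ] H)) :
    IsClosed (ContinuousLinearMapWOT.ofCLM '' Set.centralizer s :
      Set (H →WOT[ℂ] H)) := by
  have e : (ContinuousLinearMapWOT.ofCLM '' Set.centralizer s : Set (H →WOT[ℂ] H)) =
      ⋂ S ∈ s, {T : H →WOT[ℂ] H | (ContinuousLinearMapWOT.ofCLM S).comp T =
        T.comp (ContinuousLinearMapWOT.ofCLM S)} := by
    ext T
    simp only [Set.mem_image, Set.mem_iInter]
    constructor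
    · rintro ⟨T, hT, rfl⟩ S hS
      exact congrArg ContinuousLinearMapWOT.ofCLM (hT S hS)
    · intro h
      exact ⟨T.toCLM, fun S hS => congrArg ContinuousLinearMapWOT.toCLM (h S hS), rfl⟩
  rw [e]
  exact isClosed_biInter fun S _ => isClosed_eq
    (ContinuousLinearMapWOT.continuous_postcomp _) (ContinuousLinearMapWOT.continuous_precomp _)

variable [CompleteSpace H]

open ContinuousLinearMap

/-- The density step: an operator in the bicommutant of `M` is approximated by elements of `M`
on finitely many vectors at once. The projection onto the closure of `M x` in the amplified space
commutes with the amplification of `M`, so its matrix entries lie in the commutant of `M`, so it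
also commutes with the amplification of `T`. -/
theorem StarSubalgebra.exists_norm_sub_apply_lt (M : StarSubalgebra ℂ (H →L[ℂ] H))
    {T : H →L[ℂ] H} (hT : T ∈ Set.centralizer (Set.centralizer (M : Set (H →L[ℂ] H))))
    {ι : Type*} [Fintype ι] (x : ι → H) {ε : ℝ} (hε : 0 < ε) :
    ∃ a ∈ M, ∀ i, ‖(a - T) (x i)‖ < ε := by
  classical
  let z : PiLp 2 (fun _ : ι => H) := WithLp.toLp 2 x
  let Y : Submodule ℂ (PiLp 2 fun _ : ι => H) :=
    M.toSubalgebra.toSubmodule.map ((ContinuousLinearMap.apply ℂ _ z).toLinearMap ∘ₗ amplify ι)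
  let X := Y.topologicalClosure
  have memY : ∀ a ∈ M, amplify ι a z ∈ Y := fun a ha => ⟨a, ha, rfl⟩
  have : CompleteSpace X := Y.isClosed_topologicalClosure.completeSpace_coe
  have invX : ∀ a ∈ M, ∀ y ∈ X, amplify ι a y ∈ X := by
    intro a ha y hy
    refine map_mem_closure (amplify ι a).continuous hy ?_
    rintro _ ⟨b, hb, rfl⟩
    exact ⟨a * b, M.mul_mem ha hb, rfl⟩
  have inv_orthogonal : ∀ a ∈ M, ∀ y ∈ Xᗮ, amplify ι a y ∈ Xᗮ := by
    intro a ha y hy u hu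
    have h := hy _ (invX (star a) (star_mem ha) u hu)
    rw [PiLp.inner_apply] at h ⊢
    simp only [amplify_apply] at h ⊢
    rw [← h]
    refine Finset.sum_congr rfl fun i _ => ?_
    rw [star_eq_adjoint, adjoint_inner_left]
  have comm : ∀ a ∈ M, ∀ y, X.starProjection (amplify ι a y) =
      amplify ι a (X.starProjection y) := by
    intro a ha y
    refine Submodule.eq_starProjection_of_mem_orthogonal
      (invX a ha _ (Submodule.starProjection_apply_mem X y)) ?_
    rw [← map_sub]
    exact inv_orthogonal a ha _ (Submodule.sub_starProjection_mem_orthogonal y)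
  let incl (j : ι) : H →L[ℂ] PiLp 2 (fun _ : ι => H) :=
    (PiLp.continuousLinearEquiv 2 ℂ fun _ : ι => H).symm.toContinuousLinearMap ∘L
      ContinuousLinearMap.single ℂ (fun _ : ι => H) j
  have amplify_incl : ∀ (S : H →L[ℂ] H) j u, amplify ι S (incl j u) = incl j (S u) := by
    intro S j u
    ext i
    by_cases h : i = j
    · subst h; simp [amplify_apply, incl]
    · simp [amplify_apply, incl, h]
  let entry (i j : ι) : H →L[ℂ] H := PiLp.proj 2 (fun _ : ι => H) i ∘L X.starProjection ∘L incl j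
  have entry_apply : ∀ i j u, entry i j u = X.starProjection (incl j u) i := fun _ _ _ => rfl
  have entry_mem : ∀ i j, entry i j ∈ Set.centralizer (M : Set (H →L[ℂ] H)) := by
    intro i j a ha
    ext u
    change a (entry i j u) = entry i j (a u)
    rw [entry_apply, entry_apply, ← amplify_incl, comm a ha, amplify_apply]
  have sum_incl : ∀ y : PiLp 2 (fun _ : ι => H), y = ∑ j, incl j (y j) := by
    intro y
    ext i
    simp [incl, Finset.sum_apply, Pi.single_apply]
  have commT : X.starProjection (amplify ι T z) = amplify ι T (X.starProjection z) := by
    rw [sum_incl z]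
    simp only [map_sum, amplify_incl]
    refine Finset.sum_congr rfl fun j _ => ?_
    ext i
    exact (DFunLike.congr_fun (hT _ (entry_mem i j)) (z j))
  have hz : z ∈ X := Y.le_topologicalClosure (by simpa using! memY 1 M.one_mem)
  have hTz : amplify ι T z ∈ closure (Y : Set (PiLp 2 fun _ : ι => H)) := by
    change amplify ι T z ∈ X
    rw [← Submodule.starProjection_eq_self_iff, commT, Submodule.starProjection_eq_self_iff.2 hz]
  obtain ⟨_, ⟨a, ha, rfl⟩, hlt⟩ := Metric.mem_closure_iff.1 hTz ε hε
  refine ⟨a, ha, fun i => lt_of_le_of_lt ?_ hlt⟩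
  rw [dist_comm, dist_eq_norm]
  exact PiLp.norm_apply_le (amplify ι a z - amplify ι T z) i

/-- Von Neumann's double commutant theorem: the closure of a unital `*`-algebra of operators in the
weak operator topology is its bicommutant. -/
theorem StarSubalgebra.ofCLM_mem_closure_iff (M : StarSubalgebra ℂ (H →L[ℂ] H)) (T : H →L[ℂ] H) :
    (ContinuousLinearMapWOT.ofCLM T : H →WOT[ℂ] H) ∈
        closure (ContinuousLinearMapWOT.ofCLM '' (M : Set (H →L[ℂ] H))) ↔
      T ∈ Set.centralizer (Set.centralizer (M : Set (H →L[ℂ] H))) := by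
  constructor
  · intro h
    have h' := closure_minimal (Set.image_mono Set.subset_centralizer_centralizer)
      (isClosed_image_ofCLM_centralizer _) h
    obtain ⟨S, hS, e⟩ := h'
    rwa [← ContinuousLinearMapWOT.ofCLM_injective e]
  · intro hT
    rw [mem_closure_iff_nhds]
    intro U hU
    obtain ⟨s, r, hr, hs⟩ := (ContinuousLinearMapWOT.withSeminorms.mem_nhds_iff _ _).1 hU
    let C : ℝ := ∑ p ∈ s, ‖p.2‖
    have hC : 0 ≤ C := Finset.sum_nonneg fun _ _ => norm_nonneg _
    obtain ⟨a, ha, h⟩ := M.exists_norm_sub_apply_lt hT (fun p : s => p.1.1)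
      (ε := r / (C + 1)) (by positivity)
    refine ⟨ContinuousLinearMapWOT.ofCLM a, hs ?_, a, ha, rfl⟩
    rw [Seminorm.mem_ball]
    refine Seminorm.finset_sup_apply_lt hr fun p hp => ?_
    change ‖p.2 ((a - T) p.1)‖ < r
    have h1 : ‖p.2‖ ≤ C := Finset.single_le_sum (fun _ _ => norm_nonneg _) hp
    calc ‖p.2 ((a - T) p.1)‖ ≤ ‖p.2‖ * ‖(a - T) p.1‖ := p.2.le_opNorm _
      _ ≤ C * (r / (C + 1)) := mul_le_mul h1 (h ⟨p, hp⟩).le (norm_nonneg _) hC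
      _ < r := by
        rw [mul_div_assoc', div_lt_iff₀ (by positivity)]
        nlinarith

end DoubleCommutant

/-! ### Separating the terms of a series by its power moments -/

/-- If all the power moments `∑ λₙᵏ Bₙ` of a summable family vanish, for distinct positive weights
`λₙ` tending to zero, then the family vanishes: otherwise divide the `k`-th moment by `μᵏ`, where
`μ` is the largest weight with `Bₙ ≠ 0`, and let `k` tend to infinity. -/
theorem eq_zero_of_forall_tsum_pow_smul_eq_zero {ι E : Type*} [NormedAddCommGroup E]
    [NormedSpace ℂ E] [CompleteSpace E] {l : ι → ℝ} (hpos : ∀ n, 0 < l n)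
    (hinj : Function.Injective l)
    (hl : Filter.Tendsto l Filter.cofinite (nhds 0)) {B : ι → E}
    (hB : Summable fun n => ‖B n‖) (h : ∀ k : ℕ, ∑' n, (l n : ℂ) ^ k • B n = 0) (n : ι) :
    B n = 0 := by
  classical
  by_contra hn
  have hfin : {m | B m ≠ 0 ∧ l n ≤ l m}.Finite := by
    have h1 : ∀ᶠ m in Filter.cofinite, l m < l n := hl.eventually_lt_const (hpos n)
    exact (Filter.eventually_cofinite.1 h1).subset fun m hm => not_lt.2 hm.2
  obtain ⟨m, ⟨hm, hnm⟩, hmax⟩ := Set.exists_max_image _ l hfin ⟨n, hn, le_rfl⟩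
  have hle : ∀ i, B i ≠ 0 → l i ≤ l m := fun i hi =>
    (le_total (l n) (l i)).elim (fun h => hmax i ⟨hi, h⟩) fun h => h.trans hnm
  have hlim : Filter.Tendsto (fun k : ℕ => ∑' i, ((l i / l m : ℝ) : ℂ) ^ k • B i) Filter.atTop
      (nhds (∑' i, if i = m then B m else 0)) := by
    refine tendsto_tsum_of_dominated_convergence hB (fun i => ?_)
      (Filter.Eventually.of_forall fun k i => ?_)
    · by_cases hi : B i = 0
      · have : (if i = m then B m else 0) = 0 := by
          split_ifs with e
          · rw [← e, hi]
          · rfl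
        simp [hi, this]
      · by_cases e : i = m
        · subst e
          simp [div_self (hpos i).ne']
        · rw [if_neg e]
          have hlt : l i < l m := lt_of_le_of_ne (hle i hi) fun e' => e (hinj e')
          have h0 : Filter.Tendsto (fun k : ℕ => ((l i / l m : ℝ) : ℂ) ^ k) Filter.atTop
              (nhds 0) := by
            refine tendsto_pow_atTop_nhds_zero_of_norm_lt_one ?_
            rw [Complex.norm_real, Real.norm_of_nonneg (div_pos (hpos i) (hpos m)).le]
            exact (div_lt_one (hpos m)).2 hlt
          simpa using h0.smul_const (B i)
    · by_cases hi : B i = 0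
      · simp [hi]
      · rw [norm_smul, norm_pow, Complex.norm_real,
          Real.norm_of_nonneg (div_pos (hpos i) (hpos m)).le]
        exact mul_le_of_le_one_left (norm_nonneg _)
          (pow_le_one₀ (div_pos (hpos i) (hpos m)).le ((div_le_one (hpos m)).2 (hle i hi)))
  have hzero : ∀ k : ℕ, ∑' i, ((l i / l m : ℝ) : ℂ) ^ k • B i = 0 := by
    intro k
    have e : ∀ i, ((l i / l m : ℝ) : ℂ) ^ k • B i =
        ((l m : ℂ) ^ k)⁻¹ • ((l i : ℂ) ^ k • B i) := by
      intro i
      rw [smul_smul, Complex.ofReal_div, div_pow, div_eq_inv_mul]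
    simp only [e]
    rw [tsum_const_smul'', h k, smul_zero]
  simp only [hzero, tsum_ite_eq] at hlim
  exact hm (tendsto_nhds_unique hlim tendsto_const_nhds)

namespace Hyperfinite

/-! ### Generation of the algebraic tensor product by the matrix units -/

theorem site_commute {n m : ℕ} (h : n ≠ m) (a b : Mat2) : Commute (site n a) (site m b) :=
  Subtype.ext (by
    change elem _ * elem _ = elem _ * elem _
    exact elem_mul _ _ |>.trans ((congrArg elem
      (Pi.mulSingle_commute (f := fun _ => Mat2) h a b).eq).trans (elem_mul _ _).symm))

theorem matV_mul_self : matV * matV = 0 := by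
  ext i j
  fin_cases i <;> fin_cases j <;> simp [matV, Matrix.mul_apply]

theorem matV_mul_star_add : matV * star matV + star matV * matV = 1 := by
  ext i j
  fin_cases i <;> fin_cases j <;> simp [matV, Matrix.mul_apply, Matrix.star_apply, -Matrix.cons_mul]

theorem mat2_eq (a : Mat2) : a = a 0 0 • (matV * star matV) + a 0 1 • matV +
    a 1 0 • star matV + a 1 1 • (star matV * matV) := by
  ext i j
  fin_cases i <;> fin_cases j <;> simp [matV, Matrix.mul_apply, Matrix.star_apply, -Matrix.cons_mul]

/-- The matrix `V` and its adjoint generate `M₂(ℂ)`. -/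
theorem site_mem_of_matV_mem {S : Subalgebra ℂ algTensor} {n : ℕ} (h : site n matV ∈ S)
    (h' : site n (star matV) ∈ S) (a : Mat2) : site n a ∈ S := by
  rw [mat2_eq a]
  simp only [site_add, site_smul, ← site_mul]
  exact S.add_mem (S.add_mem (S.add_mem (S.smul_mem (S.mul_mem h h') _) (S.smul_mem h _))
    (S.smul_mem h' _)) (S.smul_mem (S.mul_mem h' h) _)

theorem elem_mem_of_site_mem {S : Subalgebra ℂ algTensor} (h : ∀ n a, site n a ∈ S)
    (s : Finset ℕ) : ∀ (x : ℕ → Mat2) (hx : EventuallyOne x), (∀ n ∉ s, x n = 1) →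
      (⟨elem x, elem_mem hx⟩ : algTensor) ∈ S := by
  classical
  induction s using Finset.induction_on with
  | empty =>
    intro x hx hs
    obtain rfl : x = 1 := funext fun n => hs n (Finset.notMem_empty n)
    exact S.one_mem
  | insert i s hi ih =>
    intro x hx hs
    have hu : EventuallyOne (Function.update x i 1) :=
      eventuallyOne_update i (x i) 1 (by rwa [Function.update_eq_self])
    have e : (⟨elem x, elem_mem hx⟩ : algTensor) =
        site i (x i) * ⟨elem (Function.update x i 1), elem_mem hu⟩ := by
      refine Subtype.ext ?_
      change elem x = elem _ * elem _
      rw [elem_mul]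
      congr 1
      funext n
      by_cases hn : n = i
      · subst hn; simp
      · simp [hn]
    rw [e]
    refine S.mul_mem (h _ _) (ih _ hu fun n hn => ?_)
    by_cases hni : n = i
    · subst hni; simp
    · rw [Function.update_of_ne hni]
      exact hs n (by simp [hni, hn])

theorem subalgebra_eq_top {S : Subalgebra ℂ algTensor} (h : ∀ n, site n matV ∈ S)
    (h' : ∀ n, site n (star matV) ∈ S) : S = ⊤ := by
  have hsite : ∀ n a, site n a ∈ S := fun n a => site_mem_of_matV_mem (h n) (h' n) a
  have key : ∀ t ∈ Submodule.span ℂ {t | ∃ x, EventuallyOne x ∧ elem x = t},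
      t ∈ S.toSubmodule.map algTensor.subtype.toAlgHom.toLinearMap := by
    intro t ht
    refine Submodule.span_le.2 ?_ ht
    rintro _ ⟨x, hx, rfl⟩
    have hs : {n | x n ≠ 1}.Finite := hx
    refine ⟨⟨elem x, elem_mem hx⟩, elem_mem_of_site_mem hsite hs.toFinset x hx fun n hn => ?_, rfl⟩
    by_contra h1
    exact hn (hs.mem_toFinset.2 h1)
  refine eq_top_iff.2 fun a _ => ?_
  obtain ⟨b, hb, e⟩ := key a a.2
  rwa [← Subtype.ext (show (b : FullTensor) = a from e)]

/-! ### Relations between the operators `Vₙ` -/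

instance : Nontrivial L2 := by
  refine ⟨vec 1, 0, fun h => ?_⟩
  have h1 := inner_vec 1 1
  rw [h, inner_zero_left, star_one, one_mul] at h1
  have h2 : trace (elem 1) = 1 := by
    rw [trace_elem (by simp [EventuallyOne])]
    simp [tr2_one]
  exact zero_ne_one (h1.trans h2)

theorem star_opV (n : ℕ) : star (opV n) = leftRep (site n (star matV)) := by
  rw [opV, ← map_star, site_star]

theorem opV_mul_self (n : ℕ) : opV n * opV n = 0 := by
  have h : site n (0 : Mat2) = 0 := by simpa using site_smul n 0 0
  rw [opV, ← map_mul, site_mul, matV_mul_self, h, map_zero]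

theorem opV_mul_star_add (n : ℕ) : opV n * star (opV n) + star (opV n) * opV n = 1 := by
  rw [star_opV, opV, ← map_mul, ← map_mul, ← map_add, site_mul, site_mul, ← site_add,
    matV_mul_star_add, site_one, map_one]

theorem opV_mul_star_mul (n : ℕ) : opV n * (star (opV n) * opV n) = opV n := by
  have h := congrArg (opV n * ·) (opV_mul_star_add n)
  simpa only [mul_add, mul_one, ← mul_assoc (opV n) (opV n), opV_mul_self, zero_mul, zero_add]
    using h

theorem opV_commute {n m : ℕ} (h : n ≠ m) : Commute (opV n) (opV m) :=
  (site_commute h _ _).map leftRep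

theorem opV_commute_star {n m : ℕ} (h : n ≠ m) : Commute (opV n) (star (opV m)) := by
  rw [star_opV]
  exact (site_commute h _ _).map leftRep

theorem opV_ne_zero (n : ℕ) : opV n ≠ 0 := by
  intro h
  have h1 := opV_mul_star_add n
  rw [h, zero_mul, mul_zero, add_zero] at h1
  exact zero_ne_one h1

/-- If `Vₙ Vₘ*` vanished, then so would `Vₙ = Vₙ (Vₘ Vₘ* + Vₘ* Vₘ)`. -/
theorem opV_mul_star_ne_zero {n m : ℕ} (h : n ≠ m) : opV n * star (opV m) ≠ 0 := by
  intro h0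
  refine opV_ne_zero n ?_
  calc opV n = opV n * (opV m * star (opV m) + star (opV m) * opV m) := by
        rw [opV_mul_star_add, mul_one]
    _ = opV m * (opV n * star (opV m)) + opV n * star (opV m) * opV m := by
        rw [mul_add, ← mul_assoc, ← mul_assoc, (opV_commute h).eq, mul_assoc (opV m)]
    _ = 0 := by rw [h0, mul_zero, zero_mul, add_zero]

/-! ### The commutants of `A` and of the algebraic tensor product -/

/-- The algebraic tensor product as a `*`-algebra of operators on `L2`. -/
noncomputable def operatorAlgebra : StarSubalgebra ℂ (L2 →L[ℂ] L2) := leftRep.range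

theorem hyperfiniteFactor_eq : hyperfiniteFactor =
    Set.centralizer (Set.centralizer (operatorAlgebra : Set (L2 →L[ℂ] L2))) := by
  ext T
  have h : (operatorAlgebra : Set (L2 →L[ℂ] L2)) = Set.range leftRep := by
    ext; rfl
  rw [← StarSubalgebra.ofCLM_mem_closure_iff, h]
  rfl

theorem leftRep_mem_operatorAlgebra (a : algTensor) : leftRep a ∈ operatorAlgebra := ⟨a, rfl⟩

theorem mem_hyperfiniteFactor {T : L2 →L[ℂ] L2} (h : T ∈ operatorAlgebra) :
    T ∈ hyperfiniteFactor := by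
  rw [hyperfiniteFactor_eq]
  exact Set.subset_centralizer_centralizer h

theorem opV_mem_operatorAlgebra (n : ℕ) : opV n ∈ operatorAlgebra := leftRep_mem_operatorAlgebra _

theorem mem_centralizer_of_commute_opV {T : L2 →L[ℂ] L2} (h : ∀ n, Commute T (opV n))
    (h' : ∀ n, Commute T (star (opV n))) :
    T ∈ Set.centralizer (operatorAlgebra : Set (L2 →L[ℂ] L2)) := by
  have top := subalgebra_eq_top (S := (Subalgebra.centralizer ℂ {T}).comap leftRep.toAlgHom)
    (fun n => by
      rintro _ rfl
      exact h n)
    (fun n => by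
      rintro _ rfl
      exact star_opV n ▸ h' n)
  rintro _ ⟨a, rfl⟩
  have ha : a ∈ (Subalgebra.centralizer ℂ {T}).comap leftRep.toAlgHom := top ▸ Algebra.mem_top
  exact (ha T rfl).symm

theorem commute_opA {c : ℕ → ℂ} (hc : Summable fun n => ‖c n‖) {T : L2 →L[ℂ] L2}
    (h : ∀ n, Commute T (c n • opV n)) : Commute T (opA c) := by
  have h1 := (hasSum_opA hc).mul_left T
  have h2 := (hasSum_opA hc).mul_right T
  simp only [fun n => (h n).eq] at h1
  exact h1.unique h2

theorem vonNeumannGenerated_subset {c : ℕ → ℂ} (hc : Summable fun n => ‖c n‖) :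
    vonNeumannGenerated (opA c) ⊆ hyperfiniteFactor := by
  rw [hyperfiniteFactor_eq]
  refine Set.centralizer_subset fun T hT => ?_
  have h : ∀ S ∈ operatorAlgebra, Commute T S := fun S hS => (hT S hS).symm
  have h1 : Commute T (opA c) := commute_opA hc fun n =>
    (h _ (opV_mem_operatorAlgebra n)).smul_right _
  have h2 : Commute (star T) (opA c) := commute_opA hc fun n => by
    have h3 := (h _ (star_mem (opV_mem_operatorAlgebra n))).star_star
    rw [star_star] at h3
    exact h3.smul_right _
  rintro _ (rfl | rfl)
  · exact h1.symm.eq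
  · simpa using h2.star_star.symm.eq

/-- An operator in `{A, A*}'` that fails to commute with some operator of the hyperfinite factor
shows that `W*(A)` is proper. -/
theorem vonNeumannGenerated_ssubset {c : ℕ → ℂ} (hc : Summable fun n => ‖c n‖)
    {S T : L2 →L[ℂ] L2} (hA : Commute S (opA c)) (hA' : Commute S (star (opA c)))
    (hT : T ∈ hyperfiniteFactor) (h : ¬Commute S T) :
    vonNeumannGenerated (opA c) ⊂ hyperfiniteFactor := by
  refine (Set.ssubset_iff_of_subset (vonNeumannGenerated_subset hc)).2 ⟨T, hT, fun hT' => h ?_⟩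
  refine hT' S ?_
  rintro _ (rfl | rfl)
  · exact hA.symm.eq
  · exact hA'.symm.eq

/-! ### Distinct absolute values: the commutator `[A, A*]` separates the terms of `A` -/

/-- `[T, A]` is the sum of the `cₖ [T, Vₖ]`, so the terms with `[T, Vₖ] = 0` drop out. -/
theorem commute_opA_sub_sum {c : ℕ → ℂ} (hc : Summable fun n => ‖c n‖) {s : Finset ℕ}
    {T : L2 →L[ℂ] L2} (h : ∀ k ∉ s, Commute T (opV k)) :
    Commute T (opA c - ∑ k ∈ s, c k • opV k) := by
  have h1 : HasSum (fun k => T * (c k • opV k) - c k • opV k * T) (T * opA c - opA c * T) :=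
    ((hasSum_opA hc).mul_left T).sub ((hasSum_opA hc).mul_right T)
  have h2 := h1.unique (hasSum_sum_of_ne_finset_zero fun k hk =>
    sub_eq_zero.2 ((h k hk).smul_right (c k)).eq)
  rw [Finset.sum_sub_distrib, ← Finset.mul_sum, ← Finset.sum_mul] at h2
  rw [commute_iff_eq, mul_sub, sub_mul, sub_eq_sub_iff_sub_eq_sub, h2]

theorem commute_opA_sub {c : ℕ → ℂ} (hc : Summable fun n => ‖c n‖) {n : ℕ} {T : L2 →L[ℂ] L2}
    (h : ∀ k, k ≠ n → Commute T (opV k)) : Commute T (opA c - c n • opV n) := by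
  simpa using commute_opA_sub_sum hc (s := {n}) fun k hk => h k (by simpa using hk)

/-- The derivation given by `[A, A*]` has `Vₙ` as an eigenvector, for the eigenvalue
`2 |cₙ|²`. -/
theorem commutator_mul_opV_sub {c : ℕ → ℂ} (hc : Summable fun n => ‖c n‖) (n : ℕ) :
    (opA c * star (opA c) - star (opA c) * opA c) * opV n -
      opV n * (opA c * star (opA c) - star (opA c) * opA c) =
        ((2 * ‖c n‖ ^ 2 : ℝ) : ℂ) • opV n := by
  set v := opV n
  -- The part of `A` away from the `n`-th factor commutes with `Vₙ` and with `Vₙ*`.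
  obtain ⟨B, hA⟩ : ∃ B, opA c = c n • v + B := ⟨opA c - c n • v, by abel⟩
  have hB : opA c - c n • opV n = B := by rw [hA]; abel
  have h1 : Commute v B := hB ▸ commute_opA_sub hc fun k hk => opV_commute hk.symm
  have h2 : Commute (star v) B := hB ▸ commute_opA_sub hc fun k hk =>
    (opV_commute_star hk).symm
  have h1' : Commute (star v) (star B) := h1.star_star
  have h2' : Commute v (star B) := by simpa using h2.star_star
  have hD : opA c * star (opA c) - star (opA c) * opA c =
      (c n * star (c n)) • (v * star v - star v * v) + (B * star B - star B * B) := by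
    rw [hA, star_add, star_smul]
    simp only [add_mul, mul_add, smul_mul_assoc, mul_smul_comm, smul_sub, smul_add,
      mul_smul, h2'.eq, h2.eq]
    rw [smul_comm (star (c n)) (c n)]
    abel
  have hE : Commute (B * star B - star B * B) v :=
    ((h1.mul_right h2').sub_right (h2'.mul_right h1)).symm
  rw [hD, add_mul, mul_add, hE.eq, add_sub_add_right_eq_sub, smul_mul_assoc, mul_smul_comm,
    ← smul_sub]
  have e : (v * star v - star v * v) * v - v * (v * star v - star v * v) = (2 : ℂ) • v := by
    rw [sub_mul, mul_sub, mul_assoc, opV_mul_star_mul, mul_assoc, ← mul_assoc v v,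
      opV_mul_self, mul_zero, zero_mul, two_smul]
    abel
  rw [e, smul_smul, Complex.star_def, Complex.mul_conj, Complex.normSq_eq_norm_sq]
  push_cast
  ring_nf

/-- The `k`-th iterate of the derivation given by `[A, A*]`, applied to `A`, as a series and as an
operator that commutes with the commutant of `{A, A*}`. -/
theorem hasSum_pow_smul {c : ℕ → ℂ} (hc : Summable fun n => ‖c n‖) (k : ℕ) :
    ∃ S, HasSum (fun n => ((2 * ‖c n‖ ^ 2 : ℝ) : ℂ) ^ k • c n • opV n) S ∧
      ∀ T, Commute T (opA c) → Commute T (star (opA c)) → Commute T S := by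
  induction k with
  | zero => exact ⟨opA c, by simpa using hasSum_opA hc, fun T h _ => h⟩
  | succ k ih =>
    obtain ⟨S, hS, hcomm⟩ := ih
    set D := opA c * star (opA c) - star (opA c) * opA c
    refine ⟨D * S - S * D, ?_, fun T h h' => ?_⟩
    · convert! (hS.mul_left D).sub (hS.mul_right D) using 2 with n
      simp only [mul_smul_comm, smul_mul_assoc, ← smul_sub]
      rw [commutator_mul_opV_sub hc n, smul_comm (c n), pow_succ, mul_smul]
    · have h1 : Commute T D := (h.mul_right h').sub_right (h'.mul_right h)
      exact (h1.mul_right (hcomm T h h')).sub_right ((hcomm T h h').mul_right h1)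

/-- If the `|cₙ|` are distinct and nonzero, then an operator that commutes with `A` and `A*`
commutes with every `Vₙ`. -/
theorem commute_opV_of_commute_opA {c : ℕ → ℂ} (hc : Summable fun n => ‖c n‖)
    (h0 : ∀ n, c n ≠ 0) (hne : ∀ i j, i ≠ j → ‖c i‖ ≠ ‖c j‖) {T : L2 →L[ℂ] L2}
    (h : Commute T (opA c)) (h' : Commute T (star (opA c))) (n : ℕ) : Commute T (opV n) := by
  have hB : Summable fun n => ‖c n • (T * opV n - opV n * T)‖ := by
    refine Summable.of_nonneg_of_le (fun _ => norm_nonneg _) (fun n => ?_)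
      (hc.mul_right (‖T‖ + ‖T‖))
    rw [norm_smul]
    refine mul_le_mul_of_nonneg_left ((norm_sub_le _ _).trans (add_le_add ?_ ?_)) (norm_nonneg _)
    · exact (norm_mul_le _ _).trans (mul_le_of_le_one_right (norm_nonneg _) (norm_opV_le n))
    · exact (norm_mul_le _ _).trans (mul_le_of_le_one_left (norm_nonneg _) (norm_opV_le n))
  have hlim : Filter.Tendsto (fun n => 2 * ‖c n‖ ^ 2) Filter.cofinite (nhds 0) := by
    simpa using (hc.tendsto_cofinite_zero.pow 2).const_mul 2
  have hinj : Function.Injective fun n => 2 * ‖c n‖ ^ 2 := by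
    intro i j hij
    by_contra hne'
    refine hne i j hne' ((sq_eq_sq₀ (norm_nonneg _) (norm_nonneg _)).1 ?_)
    simpa using hij
  have hpos : ∀ n, 0 < 2 * ‖c n‖ ^ 2 := fun n => by
    have := norm_pos_iff.2 (h0 n)
    positivity
  have hzero := eq_zero_of_forall_tsum_pow_smul_eq_zero hpos hinj hlim hB (fun k => by
    obtain ⟨S, hS, hcomm⟩ := hasSum_pow_smul hc k
    have h1 := (hS.mul_left T).sub (hS.mul_right T)
    simp only [mul_smul_comm, smul_mul_assoc, ← smul_sub] at h1
    rw [h1.tsum_eq, (hcomm T h h').eq, sub_self]) n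
  exact sub_eq_zero.1 ((smul_eq_zero.1 hzero).resolve_left (h0 n))

theorem vonNeumannGenerated_eq {c : ℕ → ℂ} (hc : Summable fun n => ‖c n‖)
    (h0 : ∀ n, c n ≠ 0) (hne : ∀ i j, i ≠ j → ‖c i‖ ≠ ‖c j‖) :
    vonNeumannGenerated (opA c) = hyperfiniteFactor := by
  refine (vonNeumannGenerated_subset hc).antisymm ?_
  rw [hyperfiniteFactor_eq]
  refine Set.centralizer_subset fun T hT => ?_
  have h1 : Commute T (opA c) := (hT _ (Or.inl rfl)).symm
  have h2 : Commute T (star (opA c)) := (hT _ (Or.inr rfl)).symm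
  refine mem_centralizer_of_commute_opV (commute_opV_of_commute_opA hc h0 hne h1 h2) fun n => ?_
  have h3 := commute_opV_of_commute_opA hc h0 hne (T := star T) (by simpa using h2.star_star)
    h1.star_star n
  simpa using h3.star_star

/-! ### Equal absolute values: the operator `Sₙₘ` -/

theorem opS_mem_operatorAlgebra (c : ℕ → ℂ) (n m : ℕ) : opS c n m ∈ operatorAlgebra := by
  have h := opV_mem_operatorAlgebra
  have h' : ∀ k, star (opV k) ∈ operatorAlgebra := fun k => star_mem (h k)
  have smul_mem : ∀ (r : ℂ) {x}, x ∈ operatorAlgebra → r • x ∈ operatorAlgebra :=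
    fun r _ hx => operatorAlgebra.toSubalgebra.smul_mem hx r
  exact sub_mem (sub_mem (add_mem
    (mul_mem (mul_mem (h n) (h' n)) (mul_mem (h' m) (h m)))
    (mul_mem (mul_mem (h' n) (h n)) (mul_mem (h m) (h' m))))
    (smul_mem _ (mul_mem (h n) (h' m)))) (smul_mem _ (mul_mem (h' n) (h m)))

theorem isSelfAdjoint_opS {c : ℕ → ℂ} {n m : ℕ} (hnm : n ≠ m) (h : ‖c n‖ = ‖c m‖)
    (hn : c n ≠ 0) : IsSelfAdjoint (opS c n m) := by
  have hm : c m ≠ 0 := norm_ne_zero_iff.1 (h ▸ norm_ne_zero_iff.2 hn)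
  -- Since `|cₙ| = |cₘ|`, conjugation inverts `cₙ / cₘ`, so the last two terms of `Sₙₘ` are adjoint
  -- to each other.
  have hsq : star (c n) * c n = star (c m) * c m := by
    simp only [Complex.star_def, ← Complex.normSq_eq_conj_mul_self, Complex.normSq_eq_norm_sq, h]
  have hr : star (c n / c m) = c m / c n := by
    rw [star_div₀, div_eq_div_iff (star_ne_zero.2 hm) hn, hsq, mul_comm]
  have hr' : star (c m / c n) = c n / c m := by rw [← hr, star_star]
  have h1 := (opV_commute_star hnm).eq
  have h2 := (opV_commute_star hnm.symm).eq
  have h3 := (opV_commute hnm).eq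
  have h4 := (opV_commute hnm).star_star.eq
  have hPQ : Commute (opP n) (opQ m) :=
    ((opV_commute_star hnm).mul_right (opV_commute hnm)).mul_left
      ((opV_commute hnm).star_star.mul_right (opV_commute_star hnm.symm).symm)
  have hQP : Commute (opQ n) (opP m) :=
    ((opV_commute_star hnm.symm).symm.mul_right (opV_commute hnm).star_star).mul_left
      ((opV_commute hnm).mul_right (opV_commute_star hnm))
  have hP : ∀ k, star (opP k) = opP k := fun k => by rw [opP, star_mul, star_star]
  have hQ : ∀ k, star (opQ k) = opQ k := fun k => by rw [opQ, star_mul, star_star]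
  rw [IsSelfAdjoint, opS]
  simp only [star_sub, star_add, star_mul, star_smul, star_star, hP, hQ, hr, hr', ← hPQ.eq,
    ← hQP.eq, h2, ← h1]
  abel

/-- Up to the factor `-cₙ / cₘ`, the corner `Pₙ S Qₙ` of `Sₙₘ` is `Vₙ Vₘ*`; it would vanish if `S`
commuted with `Pₙ`. -/
theorem not_commute_opS_opP {c : ℕ → ℂ} {n m : ℕ} (hnm : n ≠ m) (hn : c n ≠ 0) (hm : c m ≠ 0) :
    ¬Commute (opS c n m) (opP n) := by
  intro h
  have h1a : ∀ x, star (opV n) * (star (opV n) * x) = 0 := fun x => by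
    rw [← mul_assoc, ← star_mul, opV_mul_self, star_zero, zero_mul]
  have h2a : ∀ x, opV n * (star (opV n) * (opV n * x)) = opV n * x := fun x => by
    rw [← mul_assoc (star _), ← mul_assoc, opV_mul_star_mul]
  have c1 := (opV_commute hnm).symm.eq
  have c2a := fun x => (opV_commute_star hnm.symm).left_comm x
  have c3 := (opV_commute_star hnm).symm.eq
  have c3a := fun x => (opV_commute_star hnm).symm.left_comm x
  have c4a := fun x => (opV_commute hnm.symm).star_star.left_comm x
  -- The simplifier moves the factors `Vₙ`, `Vₙ*` to the left of `Vₘ`, `Vₘ*`.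
  have corner : opP n * opS c n m * opQ n = -((c n / c m) • (opV n * star (opV m))) := by
    simp only [opS, opP, opQ, mul_sub, mul_add, sub_mul, mul_smul_comm, smul_mul_assoc,
      mul_assoc, h1a, h2a, c1, c2a, c3, c3a, c4a, mul_zero, smul_zero,
      add_zero, sub_zero, zero_sub]
  have hPQ : opP n * opQ n = 0 := by
    simp only [opP, opQ, mul_assoc, h1a, mul_zero]
  rw [← h.eq, mul_assoc, hPQ, mul_zero, zero_eq_neg, smul_eq_zero] at corner
  exact corner.elim (div_ne_zero hn hm) (opV_mul_star_ne_zero hnm)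

/-- `Sₙₘ` commutes with `cₙ Vₙ + cₘ Vₘ`, and with all other `Vₖ`. -/
theorem opS_commute_opA {c : ℕ → ℂ} (hc : Summable fun n => ‖c n‖) {n m : ℕ} (hnm : n ≠ m)
    (hn : c n ≠ 0) (hm : c m ≠ 0) : Commute (opS c n m) (opA c) := by
  have rest : Commute (opS c n m) (opA c - (c n • opV n + c m • opV m)) := by
    rw [← Finset.sum_pair (f := fun k => c k • opV k) hnm]
    refine commute_opA_sub_sum hc fun k hk => ?_
    obtain ⟨hkn, hkm⟩ : k ≠ n ∧ k ≠ m := by simpa using hk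
    have v : ∀ {i}, k ≠ i → Commute (opV i) (opV k) := fun h => (opV_commute h).symm
    have v' : ∀ {i}, k ≠ i → Commute (star (opV i)) (opV k) := fun h => (opV_commute_star h).symm
    exact (((((v hkn).mul_left (v' hkn)).mul_left ((v' hkm).mul_left (v hkm))).add_left
      (((v' hkn).mul_left (v hkn)).mul_left ((v hkm).mul_left (v' hkm)))).sub_left
      (((v hkn).mul_left (v' hkm)).smul_left _)).sub_left
      (((v' hkn).mul_left (v hkm)).smul_left _)
  have pair : Commute (opS c n m) (c n • opV n + c m • opV m) := by
    have h1 := fun k => opV_mul_self k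
    have h1a : ∀ k x, opV k * (opV k * x) = 0 := fun k x => by rw [← mul_assoc, h1, zero_mul]
    have h3 := fun k => opV_mul_star_mul k
    have h3a : ∀ k x, opV k * (star (opV k) * (opV k * x)) = opV k * x := fun k x => by
      rw [← mul_assoc (star _), ← mul_assoc, h3]
    have c1 := (opV_commute hnm).symm.eq
    have c1a := fun x => (opV_commute hnm).symm.left_comm x
    have c2a := fun x => (opV_commute_star hnm.symm).left_comm x
    have c3 := (opV_commute_star hnm).symm.eq
    have c3a := fun x => (opV_commute_star hnm).symm.left_comm x
    have e1 : c m * (c n / c m) = c n := mul_div_cancel₀ _ hm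
    have e2 : c n * (c m / c n) = c m := mul_div_cancel₀ _ hn
    have e1' : c n / c m * c m = c n := div_mul_cancel₀ _ hm
    have e2' : c m / c n * c n = c m := div_mul_cancel₀ _ hn
    -- Once `Vₙ`, `Vₙ*` are moved to the left of `Vₘ`, `Vₘ*`, the terms of each of the two products
    -- cancel in pairs.
    rw [commute_iff_eq]
    simp only [opS, opP, opQ, mul_sub, mul_add, sub_mul, add_mul, mul_smul_comm, smul_mul_assoc,
      mul_assoc, h1, h1a, h3, h3a, c1, c1a, c2a, c3, c3a, mul_zero,
      smul_zero, smul_add, smul_sub]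
    simp only [smul_smul, e1, e2, e1', e2']
    abel
  simpa using rest.add_right pair

theorem vonNeumannGenerated_ssubset_of_norm_eq {c : ℕ → ℂ} (hc : Summable fun n => ‖c n‖)
    {n m : ℕ} (hnm : n ≠ m) (h : ‖c n‖ = ‖c m‖) :
    vonNeumannGenerated (opA c) ⊂ hyperfiniteFactor ∧
      (c n ≠ 0 →
        opS c n m ∈ hyperfiniteFactor ∧
        IsSelfAdjoint (opS c n m) ∧
        (∀ z : ℂ, opS c n m ≠ z • 1) ∧
        Commute (opS c n m) (opA c)) := by
  by_cases hn : c n = 0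
  · refine ⟨?_, fun h' => absurd hn h'⟩
    -- Here `Vₙ` does not occur in `A`, so it lies in the commutant of `A` and `A*`.
    have hA : ∀ T, (∀ k, k ≠ n → Commute T (opV k)) → Commute T (opA c) := fun T hT => by
      simpa [hn] using commute_opA_sub hc hT
    refine vonNeumannGenerated_ssubset hc (S := opV n) (T := star (opV n))
      (hA _ fun k hk => opV_commute hk.symm) ?_
      (mem_hyperfiniteFactor (star_mem (opV_mem_operatorAlgebra n))) fun hcomm => ?_
    · simpa using (hA (star (opV n)) fun k hk => (opV_commute_star hk).symm).star_star
    · refine opV_ne_zero n ?_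
      rw [← opV_mul_star_mul n, ← hcomm.eq, ← mul_assoc, opV_mul_self, zero_mul]
  · have hm : c m ≠ 0 := norm_ne_zero_iff.1 (h ▸ norm_ne_zero_iff.2 hn)
    have hS := isSelfAdjoint_opS hnm h hn
    have hSA := opS_commute_opA hc hnm hn hm
    have hSP := not_commute_opS_opP hnm hn hm
    have hSA' : Commute (opS c n m) (star (opA c)) := by
      simpa only [hS.star_eq] using hSA.star_star
    refine ⟨vonNeumannGenerated_ssubset hc hSA hSA' (mem_hyperfiniteFactor
      (mul_mem (opV_mem_operatorAlgebra n) (star_mem (opV_mem_operatorAlgebra n)))) hSP, fun _ =>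
      ⟨mem_hyperfiniteFactor (opS_mem_operatorAlgebra c n m), hS, fun z hz => hSP ?_, hSA⟩⟩
    rw [hz]
    exact (Commute.one_left _).smul_left z

end Hyperfinite

theorem mainTheorem2 (c : ℕ → ℂ) (hc : Summable fun n => ‖c n‖) :
    ((∀ n, c n ≠ 0) → (∀ i j, i ≠ j → ‖c i‖ ≠ ‖c j‖) →
      Hyperfinite.vonNeumannGenerated (Hyperfinite.opA c) = Hyperfinite.hyperfiniteFactor) ∧
    (∀ n m, n ≠ m → ‖c n‖ = ‖c m‖ →
      Hyperfinite.vonNeumannGenerated (Hyperfinite.opA c) ⊂ Hyperfinite.hyperfiniteFactor ∧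
      (c n ≠ 0 →
        Hyperfinite.opS c n m ∈ Hyperfinite.hyperfiniteFactor ∧
        IsSelfAdjoint (Hyperfinite.opS c n m) ∧
        (∀ z : ℂ, Hyperfinite.opS c n m ≠ z • 1) ∧
        Commute (Hyperfinite.opS c n m) (Hyperfinite.opA c))) :=
  ⟨Hyperfinite.vonNeumannGenerated_eq hc, fun _ _ hnm h =>
    Hyperfinite.vonNeumannGenerated_ssubset_of_norm_eq hc hnm h⟩
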